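/- **Theorem (local superlinear convergence of the structured stochastic quasi-Newton method).** Let $\Psi(\theta)=\frac1N\sum_{i=1}^N \ell_i(f_i(\theta))$ on $\mathbb R^n$, where $f_i:\mathbb R^n\to\mathbb R^m$ (the model output on the $i$-th data point) and $\ell_i:\mathbb R^m\to\mathbb R$ (its loss) are twice differentiable. Write $J_i(\theta)=\nabla_\theta f_i(\theta)\in\mathbb R^{n\times m}$ (its $j$-th column is the gradient of the $j$-th component $f_i^j$), $$H_i(\theta)=J_i(\theta)\,\nabla^2\ell_i(f_i(\theta))\,J_i(\theta)^\top,\qquad \Pi_i(\theta)=\sum_{j=1}^m \partial_j\ell_i(f_i(\theta))\,\nabla^2 f_i^j(\theta).$$ Let $\theta^*$ be a local minimizer of $\Psi$ with $\nabla^2\Psi(\theta^*)$ positive definite. Assume that there is $\tilde\lambda>0$ with $\Pi_i(\theta^*)\succeq\tilde\lambda I$ for $i=1,\dots,N$, and that, on some neighbourhood of $\theta^*$, for all $i$ and $j$, * $\theta\mapsto\nabla\ell_i(f_i(\theta))$ and $\theta\mapsto\nabla^2\ell_i(f_i(\theta))$ are bounded, and the latter is Lipschitz continuous; * $\nabla f_i^j$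 and $\nabla^2 f_i^j$ are bounded, and $\nabla^2 f_i^j$ is Lipschitz continuous. Let $s_0,s_1,\dots$ be positive integers that grow superlinearly, in the sense that $\sum_k 1/s_k<\infty$ (for example $s_k\ge c\,k^{p}$ with $c>0$, $p>1$, or $s_{k+1}/s_k\to\infty$). At each iteration $k$ a sample $S_k$ of indices from $\{1,\dots,N\}$ is drawn uniformly at random, either (for all $k$) with replacement and of size $s_k$, or (for all $k$) without replacement and of size $\min\{s_k,N\}$. Let $\theta_k\in\mathbb R^n$ and $\Lambda_k\in\mathbb R^{n\times n}$ be random sequences such that, almost surely, for all $k\ge0$, $$B_k=\frac1{|S_k|}\sum_{i\in S_k}H_i(\theta_k)+\Lambda_k\ \text{ is invertible},\qquad \theta_{k+1}=\theta_k-B_k^{-1}\nabla\Psi(\theta_k),$$ and such that the refinement matrices are generated by the BFGS method: $\Lambda_0$ is symmetric positive definite and, with $$u_k=\theta_{k+1}-\theta_k,\qquad v_k=\frac1{|S_k|}\sum_{i\in S_k}\bigl(J_i(\theta_{k+1})-J_i(\theta_k)\bigr)\nabla\ell_i(f_i(\theta_{k+1})),$$ one has $$\Lambda_{k+1}=\Lambda_k-\frac{\Lambda_ku_ku_k^\top\Lambda_k}{u_k^\top\Lambda_ku_k}+\frac{v_kv_k^\top}{u_k^\top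 v_k}\qquad\text{whenever } u_k^\top v_k>0$$ (so that then the secant condition $\Lambda_{k+1}u_k=v_k$ holds), while for $u_k^\top v_k\le0$, where this update does not preserve positive definiteness, $\Lambda_{k+1}$ may be any symmetric positive definite matrix (for example $\Lambda_{k+1}=\Lambda_k$). If $\sum_k\|\theta_k-\theta^*\|<\infty$ almost surely, then almost surely $\theta_k\to\theta^*$ superlinearly, that is, $\theta_k\to\theta^*$ and $\|\theta_{k+1}-\theta^*\|=o(\|\theta_k-\theta^*\|)$ as $k\to\infty$. -/

import Mathlib

open MeasureTheory ProbabilityTheory Filter Topology Asymptotics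
open scoped Matrix Matrix.Norms.L2Operator

noncomputable section

namespace S2QN

/-- `ℝ^d` with the Euclidean norm. -/
abbrev Vec (d : ℕ) : Type := EuclideanSpace ℝ (Fin d)

/-- `g` is twice differentiable on the whole space. -/
def TwiceDifferentiable {d : ℕ} (g : Vec d → ℝ) : Prop :=
  Differentiable ℝ g ∧ Differentiable ℝ (fderiv ℝ g)

/-- The Hessian matrix of `g` at `x`. -/
def hessian {d : ℕ} (g : Vec d → ℝ) (x : Vec d) : Matrix (Fin d) (Fin d) ℝ :=
  Matrix.of fun a b =>
    fderiv ℝ (fderiv ℝ g) x (EuclideanSpace.single a 1) (EuclideanSpace.single b 1)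

/-- The `n × m` matrix `∇_θ F(θ)`; its `j`-th column is the gradient of the `j`-th component
of `F`. -/
def jac {n m : ℕ} (F : Vec n → Vec m) (θ : Vec n) : Matrix (Fin n) (Fin m) ℝ :=
  Matrix.of fun a j => gradient (fun t => F t j) θ a

section Problem

variable {N n m : ℕ}

/-- `Ψ(θ) = (1/N) ∑ i, ℓ_i(f_i(θ))`, where `f_i = f(x_i, ·)` is the model output on the `i`-th
data point and `ℓ_i = ℓ(·, y_i)` is its loss. -/
def objective (f : Fin N → Vec n → Vec m) (ℓ : Fin N → Vec m → ℝ) (θ : Vec n) : ℝ :=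
  (N : ℝ)⁻¹ * ∑ i, ℓ i (f i θ)

/-- The `i`-th generalized Gauss-Newton matrix `H_i(θ) = J_i(θ) ∇²ℓ_i(f_i(θ)) J_i(θ)ᵀ`. -/
def ggn (f : Fin N → Vec n → Vec m) (ℓ : Fin N → Vec m → ℝ) (i : Fin N) (θ : Vec n) :
    Matrix (Fin n) (Fin n) ℝ :=
  jac (f i) θ * hessian (ℓ i) (f i θ) * (jac (f i) θ)ᵀ

/-- The `i`-th remaining part of the Hessian,
`Π_i(θ) = ∑ j, (∂_j ℓ_i)(f_i(θ)) ∇²f_i^j(θ)`. -/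
def residual (f : Fin N → Vec n → Vec m) (ℓ : Fin N → Vec m → ℝ) (i : Fin N) (θ : Vec n) :
    Matrix (Fin n) (Fin n) ℝ :=
  ∑ j, gradient (ℓ i) (f i θ) j • hessian (fun t => f i t j) θ

/-- The average of `F` over the sample `S = (S_0, …, S_{s-1})`. -/
def sampleMean {s : ℕ} {V : Type*} [AddCommGroup V] [Module ℝ V]
    (S : Fin s → Fin N) (F : Fin N → V) : V :=
  (s : ℝ)⁻¹ • ∑ a, F (S a)

/-- The subsampled generalized Gauss-Newton matrix `H_S(θ)`. -/
def subsampledGGN (f : Fin N → Vec n → Vec m) (ℓ : Fin N → Vec m → ℝ) {s : ℕ}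
    (S : Fin s → Fin N) (θ : Vec n) : Matrix (Fin n) (Fin n) ℝ :=
  sampleMean S fun i => ggn f ℓ i θ

/-- The structured secant vector
`v = (1/|S|) ∑_{i ∈ S} (J_i(θ') - J_i(θ)) ∇ℓ_i(f_i(θ'))` for a step from `θ` to `θ'`. -/
def secantVec (f : Fin N → Vec n → Vec m) (ℓ : Fin N → Vec m → ℝ) {s : ℕ}
    (S : Fin s → Fin N) (θ θ' : Vec n) : Fin n → ℝ :=
  sampleMean S fun i =>
    (jac (f i) θ' - jac (f i) θ) *ᵥ (fun j => gradient (ℓ i) (f i θ') j)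

/-- Boundedness and Lipschitz continuity near `θs` of the first and second derivatives of the
losses (as functions of `θ`) and of the model outputs. -/
def RegularNear (f : Fin N → Vec n → Vec m) (ℓ : Fin N → Vec m → ℝ) (θs : Vec n) : Prop :=
  ∃ κl κl' Ll κf κf' Lf : ℝ, ∃ U ∈ 𝓝 θs,
    (∀ i, ∀ θ ∈ U, ‖gradient (ℓ i) (f i θ)‖ ≤ κl ∧ ‖hessian (ℓ i) (f i θ)‖ ≤ κl') ∧
    (∀ i, ∀ θ₁ ∈ U, ∀ θ₂ ∈ U,
      ‖hessian (ℓ i) (f i θ₁) - hessian (ℓ i) (f i θ₂)‖ ≤ Ll * ‖θ₁ - θ₂‖) ∧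
    (∀ i j, ∀ θ ∈ U, ‖gradient (fun t => f i t j) θ‖ ≤ κf ∧
      ‖hessian (fun t => f i t j) θ‖ ≤ κf') ∧
    (∀ i j, ∀ θ₁ ∈ U, ∀ θ₂ ∈ U,
      ‖hessian (fun t => f i t j) θ₁ - hessian (fun t => f i t j) θ₂‖ ≤ Lf * ‖θ₁ - θ₂‖)

end Problem

/-- The BFGS update `Λ - Λ u uᵀ Λ / (uᵀ Λ u) + v vᵀ / (uᵀ v)`. -/
def bfgs {n : ℕ} (Λ : Matrix (Fin n) (Fin n) ℝ) (u v : Fin n → ℝ) : Matrix (Fin n) (Fin n) ℝ :=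
  Λ - (u ⬝ᵥ Λ *ᵥ u)⁻¹ • (Λ * Matrix.vecMulVec u u * Λ) + (u ⬝ᵥ v)⁻¹ • Matrix.vecMulVec v v

/-- The BFGS matrix satisfies the secant equation. -/
theorem bfgs_mulVec {n : ℕ} {Λ : Matrix (Fin n) (Fin n) ℝ} (hΛ : Λ.PosDef) {u v : Fin n → ℝ}
    (huv : 0 < u ⬝ᵥ v) : bfgs Λ u v *ᵥ u = v := by
  have hu : u ≠ 0 := by
    rintro rfl
    simp at huv
  have hpos : (0 : ℝ) < u ⬝ᵥ Λ *ᵥ u := by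
    have := hΛ.dotProduct_mulVec_pos hu
    simpa using this
  have h1 : (Λ * Matrix.vecMulVec u u * Λ) *ᵥ u = (u ⬝ᵥ Λ *ᵥ u) • (Λ *ᵥ u) := by
    rw [← Matrix.mulVec_mulVec, ← Matrix.mulVec_mulVec, Matrix.vecMulVec_mulVec]
    simp [Matrix.mulVec_smul]
  have h2 : Matrix.vecMulVec v v *ᵥ u = (u ⬝ᵥ v) • v := by
    rw [Matrix.vecMulVec_mulVec, dotProduct_comm]
    simp
  rw [bfgs, Matrix.add_mulVec, Matrix.sub_mulVec, Matrix.smul_mulVec, Matrix.smul_mulVec, h1, h2,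
    smul_smul, smul_smul, inv_mul_cancel₀ hpos.ne', inv_mul_cancel₀ huv.ne']
  simp

/-- `Λ` is generated by the BFGS method from the pairs `(u_k, v_k)`: the initial matrix is
positive definite, and the update is performed whenever it preserves positive definiteness, that
is, whenever `u_kᵀ v_k > 0`. In the other case the choice of the next matrix is left open (for
instance the update is skipped), as long as the matrix remains positive definite. -/
def GeneratedByBFGS {n : ℕ} (Λ : ℕ → Matrix (Fin n) (Fin n) ℝ) (u v : ℕ → Fin n → ℝ) : Prop :=
  (Λ 0).PosDef ∧ ∀ k,
    (0 < u k ⬝ᵥ v k → Λ (k + 1) = bfgs (Λ k) (u k) (v k)) ∧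
    (¬ 0 < u k ⬝ᵥ v k → (Λ (k + 1)).PosDef)

/-- Each sample is drawn uniformly from `{1, …, N}`, either always with replacement (the `k`-th
sample is then a uniformly distributed `s_k`-tuple of indices, so its entries are i.i.d. uniform),
or always without replacement (it is then a uniformly distributed tuple of `min (s_k) N` distinct
indices). -/
def UniformSampling {Ω : Type*} [MeasurableSpace Ω] (μ : Measure Ω) {N : ℕ} (s : ℕ → ℕ)
    {r : ℕ → ℕ} (S : ∀ k, Ω → Fin (r k) → Fin N) : Prop :=
  (∀ k, r k = s k ∧ μ.map (S k) = uniformOn Set.univ) ∨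
  (∀ k, r k = min (s k) N ∧ μ.map (S k) = uniformOn {x | Function.Injective x})

/-- Superlinear growth of the (positive) sample sizes: `∑ 1 / s_k < ∞`. It holds if
`s_k ≥ c k ^ p` for some `c > 0` and `p > 1`, and also if `s_{k+1} / s_k → ∞`; for nondecreasing
sizes it forces `s_k / k → ∞`. -/
def SuperlinearGrowth (s : ℕ → ℕ) : Prop :=
  (∀ k, 0 < s k) ∧ Summable fun k => 1 / (s k : ℝ)

end S2QN

end

/-! Write `A` for the mean of the `Π_i(θ*)`, which is positive definite, and `G` for the Hessian of
the objective at `θ*`, which is `A` plus the mean of the `H_i(θ*)`.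

Randomness enters only through the frequencies `freq`. With replacement, their mean square deviation
from `1/N` is at most `1/s_k`; without replacement, it is eventually zero. Hence almost surely the
deviations are square summable (`summable_sq_freq_sub`), and the rest is deterministic along one
trajectory. No independence of samples and iterates is needed.

Along such a trajectory `v_k = A u_k + w_k` with `‖w_k‖ ≤ ε_k ‖u_k‖` and `∑ ε_k² < ∞`
(`exists_secantVec_error`). The potential `tr(A⁻¹Λ) - log det Λ` is bounded below. A BFGS step
lowers it by a nonnegative amount that measures the distance between `Λ u` and `A u`, up to an error
of order `ε_k²`: the contributions of first order in `w_k` are absorbed (`potential_bfgs_le`). This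
is why square summability suffices. The decreases are therefore summable and tend to zero, so `(Λ_k
- A) u_k = o(‖u_k‖)` (`bfgs_isLittleO`).

The subsampled Gauss-Newton matrices converge to the mean of the `H_i(θ*)`, so `(B_k - G) u_k =
o(‖u_k‖)`. This is the Dennis-Moré condition, which yields superlinear convergence
(`superlinear_of_dennisMore`). -/

namespace S2QN

/-! ### Sampling errors. -/

/-- The relative frequency of the index `i` in the sample `S`. -/
noncomputable def freq {N s : ℕ} (S : Fin s → Fin N) (i : Fin N) : ℝ :=
  sampleMean S fun j => if j = i then (1 : ℝ) else 0

theorem sampleMean_eq_sum_freq {N s : ℕ} {V : Type*} [AddCommGroup V] [Module ℝ V]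
    (S : Fin s → Fin N) (F : Fin N → V) : sampleMean S F = ∑ i, freq S i • F i := by
  simp only [freq, sampleMean, smul_eq_mul, mul_smul, ← Finset.smul_sum]
  congr 1
  simp only [Finset.sum_smul, ite_smul, one_smul, zero_smul]
  rw [Finset.sum_comm]
  simp

/-- The variance of a sum of independent centred variables, as a count over all tuples: splitting
off one coordinate, the cross terms vanish because `c` sums to zero. -/
theorem sum_sq_sum_le {N : ℕ} (c : Fin N → ℝ) (hc : ∑ i, c i = 0) (hc1 : ∀ i, c i ^ 2 ≤ 1)
    (s : ℕ) : ∑ x : Fin s → Fin N, (∑ a, c (x a)) ^ 2 ≤ s * (N : ℝ) ^ s := by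
  induction s with
  | zero => simp
  | succ s ih =>
    rw [← (Fin.consEquiv fun _ => Fin N).sum_comp, Fintype.sum_prod_type]
    simp only [Fin.consEquiv_apply, Fin.sum_univ_succ, Fin.cons_zero, Fin.cons_succ, add_sq,
      Finset.sum_add_distrib]
    have h1 : ∑ i : Fin N, ∑ x : Fin s → Fin N, c i ^ 2 ≤ (N : ℝ) ^ (s + 1) := by
      calc ∑ i : Fin N, ∑ x : Fin s → Fin N, c i ^ 2
          ≤ ∑ i : Fin N, ∑ x : Fin s → Fin N, (1 : ℝ) :=
            Finset.sum_le_sum fun i _ => Finset.sum_le_sum fun x _ => hc1 i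
        _ = (N : ℝ) ^ (s + 1) := by simp [pow_succ, mul_comm]
    have h2 : ∑ i : Fin N, ∑ x : Fin s → Fin N, 2 * c i * ∑ a, c (x a) = 0 := by
      rw [Finset.sum_comm]
      refine Finset.sum_eq_zero fun x _ => ?_
      rw [← Finset.sum_mul, ← Finset.mul_sum, hc]
      simp
    have h3 : ∑ i : Fin N, ∑ x : Fin s → Fin N, (∑ a, c (x a)) ^ 2 ≤ N * (s * (N : ℝ) ^ s) := by
      simpa using mul_le_mul_of_nonneg_left ih (Nat.cast_nonneg (α := ℝ) N)
    rw [h2]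
    push_cast
    calc _ ≤ (N : ℝ) ^ (s + 1) + 0 + N * (s * (N : ℝ) ^ s) := by gcongr
      _ = _ := by ring

theorem freq_sub_eq {N s : ℕ} (hs : 0 < s) (S : Fin s → Fin N) (i : Fin N) :
    freq S i - (N : ℝ)⁻¹ = (s : ℝ)⁻¹ * ∑ a, ((if S a = i then (1 : ℝ) else 0) - (N : ℝ)⁻¹) := by
  have : (s : ℝ) ≠ 0 := by positivity
  rw [Finset.sum_sub_distrib, mul_sub]
  simp [freq, sampleMean, this]

theorem sum_sq_freq_sub_le {N s : ℕ} (hs : 0 < s) (i : Fin N) :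
    ∑ S : Fin s → Fin N, (freq S i - (N : ℝ)⁻¹) ^ 2 ≤ (N : ℝ) ^ s * (1 / s) := by
  have hN : 0 < N := i.pos
  have hN' : (1 : ℝ) ≤ N := by exact_mod_cast hN
  have hs' : (0 : ℝ) < s := by exact_mod_cast hs
  simp only [freq_sub_eq hs, mul_pow, ← Finset.mul_sum]
  have := sum_sq_sum_le (fun j : Fin N => (if j = i then (1 : ℝ) else 0) - (N : ℝ)⁻¹)
    (by simp [hN.ne']) (fun j => by
      have h0 : 0 < (N : ℝ)⁻¹ := by positivity
      have h1 : (N : ℝ)⁻¹ ≤ 1 := inv_le_one_of_one_le₀ hN'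
      split_ifs <;> nlinarith) s
  calc _ ≤ ((s : ℝ)⁻¹) ^ 2 * (s * (N : ℝ) ^ s) := by gcongr
    _ = _ := by field_simp

theorem lintegral_uniformOn_univ {α : Type*} [Fintype α] [MeasurableSpace α]
    [MeasurableSingletonClass α] (g : α → ENNReal) :
    ∫⁻ x, g x ∂uniformOn (Set.univ : Set α) = (Fintype.card α : ENNReal)⁻¹ * ∑ x, g x := by
  rw [uniformOn, ProbabilityTheory.cond, lintegral_smul_measure]
  simp [lintegral_count, tsum_fintype]

/-- `Measure.map` takes the default value zero on maps that are not a.e. measurable, so a law of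
mass one forces measurability. -/
theorem aemeasurable_of_map_eq_uniformOn {Ω α : Type*} [MeasurableSpace Ω] {μ : Measure Ω}
    [MeasurableSpace α] [MeasurableSingletonClass α] {X : Ω → α} {t : Set α} (ht : t.Finite)
    (ht' : t.Nonempty) (h : μ.map X = uniformOn t) : AEMeasurable X μ := by
  by_contra hX
  have := isProbabilityMeasure_uniformOn ht ht'
  rw [Measure.map_of_not_aemeasurable hX] at h
  exact IsProbabilityMeasure.ne_zero (uniformOn t) h.symm

theorem lintegral_sq_freq_sub_le {Ω : Type*} [MeasurableSpace Ω] {μ : Measure Ω} {N s : ℕ}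
    (hs : 0 < s) (S : Ω → Fin s → Fin N) (hS : μ.map S = uniformOn Set.univ) (i : Fin N) :
    ∫⁻ ω, ENNReal.ofReal ((freq (S ω) i - (N : ℝ)⁻¹) ^ 2) ∂μ ≤ ENNReal.ofReal (1 / s) := by
  have hN : 0 < N := i.pos
  have hmeas : AEMeasurable S μ :=
    aemeasurable_of_map_eq_uniformOn Set.finite_univ ⟨fun _ => i, trivial⟩ hS
  have h1 : ∫⁻ ω, ENNReal.ofReal ((freq (S ω) i - (N : ℝ)⁻¹) ^ 2) ∂μ
      = ∫⁻ x, ENNReal.ofReal ((freq x i - (N : ℝ)⁻¹) ^ 2) ∂(μ.map S) :=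
    (lintegral_map' (f := fun x => ENNReal.ofReal ((freq x i - (N : ℝ)⁻¹) ^ 2))
      (measurable_of_finite _).aemeasurable hmeas).symm
  rw [h1, hS, lintegral_uniformOn_univ, ← ENNReal.ofReal_sum_of_nonneg fun _ _ => sq_nonneg _]
  calc _ ≤ (Fintype.card (Fin s → Fin N) : ENNReal)⁻¹
        * ENNReal.ofReal ((N : ℝ) ^ s * (1 / s)) := by
        gcongr
        exact sum_sq_freq_sub_le hs i
    _ = _ := by
        have hN0 : (N : ENNReal) ^ s ≠ 0 := by simp [hN.ne']
        have hNt : (N : ENNReal) ^ s ≠ ⊤ := by simp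
        rw [ENNReal.ofReal_mul (by positivity), ENNReal.ofReal_pow (by positivity), ← mul_assoc]
        simp [ENNReal.inv_mul_cancel hN0 hNt]

theorem freq_eq_of_injective {N s : ℕ} (hsN : s = N) {S : Fin s → Fin N}
    (hS : Function.Injective S) (i : Fin N) : freq S i = (N : ℝ)⁻¹ := by
  subst hsN
  have hbij : Function.Bijective S := Finite.injective_iff_bijective.mp hS
  simp only [freq, sampleMean, smul_eq_mul]
  rw [hbij.sum_comp fun j => if j = i then (1 : ℝ) else 0]
  simp

/-- Almost surely the sampling errors are square summable. -/
theorem summable_sq_freq_sub {Ω : Type*} [MeasurableSpace Ω] {μ : Measure Ω}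
    {N : ℕ} {s : ℕ → ℕ} (hs : SuperlinearGrowth s) {r : ℕ → ℕ}
    {S : ∀ k, Ω → Fin (r k) → Fin N} (hS : UniformSampling μ s S) :
    ∀ᵐ ω ∂μ, ∀ i, Summable fun k => (freq (S k ω) i - (N : ℝ)⁻¹) ^ 2 := by
  rw [ae_all_iff]
  intro i
  have hN : 0 < N := i.pos
  obtain h | h := hS
  · have hmeas k : AEMeasurable (S k) μ :=
      aemeasurable_of_map_eq_uniformOn Set.finite_univ ⟨fun _ => i, trivial⟩ (h k).2
    have hmeas' k :
        AEMeasurable (fun ω => ENNReal.ofReal ((freq (S k ω) i - (N : ℝ)⁻¹) ^ 2)) μ :=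
      (measurable_of_finite fun x : Fin (r k) → Fin N =>
        ENNReal.ofReal ((freq x i - (N : ℝ)⁻¹) ^ 2)).comp_aemeasurable (hmeas k)
    -- By Tonelli the expected sum of squares is at most `∑ 1/s_k`, so the sum is finite almost
    -- surely.
    have hfin : ∫⁻ ω, ∑' k, ENNReal.ofReal ((freq (S k ω) i - (N : ℝ)⁻¹) ^ 2) ∂μ ≠ ⊤ := by
      rw [lintegral_tsum hmeas']
      refine ne_top_of_le_ne_top hs.2.tsum_ofReal_ne_top (ENNReal.tsum_le_tsum fun k => ?_)
      rw [← (h k).1]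
      exact lintegral_sq_freq_sub_le ((h k).1 ▸ hs.1 k) (S k) (h k).2 i
    filter_upwards [ae_lt_top' (AEMeasurable.tsum hmeas') hfin] with ω hω
    exact (ENNReal.summable_toReal hω.ne).congr fun k => ENNReal.toReal_ofReal (sq_nonneg _)
  · have hinj k : ∀ᵐ ω ∂μ, Function.Injective (S k ω) := by
      have hfin : {x : Fin (r k) → Fin N | Function.Injective x}.Finite := Set.toFinite _
      have hne : {x : Fin (r k) → Fin N | Function.Injective x}.Nonempty :=
        ⟨Fin.castLE ((h k).1 ▸ min_le_right _ _), Fin.castLE_injective _⟩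
      have hm := aemeasurable_of_map_eq_uniformOn hfin hne (h k).2
      refine ae_of_ae_map hm ?_
      rw [(h k).2, uniformOn]
      exact ae_cond_mem hfin.measurableSet
    filter_upwards [ae_all_iff.mpr hinj] with ω hω
    -- Once `s_k ≥ N`, an injective sample lists every index exactly once and the error is zero;
    -- only finitely many terms remain.
    have hlim : Tendsto (fun k => (s k : ℝ)) atTop atTop := by
      have h1 := hs.2.tendsto_atTop_zero
      have h2 : Tendsto (fun k => 1 / (s k : ℝ)) atTop (𝓝[>] 0) :=
        tendsto_nhdsWithin_iff.mpr ⟨h1, .of_forall fun k => by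
          have := hs.1 k
          simp only [Set.mem_Ioi]
          positivity⟩
      exact h2.inv_tendsto_nhdsGT_zero.congr fun k => by simp
    obtain ⟨K, hK⟩ := eventually_atTop.mp (hlim.eventually_ge_atTop (N : ℝ))
    refine summable_of_ne_finset_zero (s := Finset.range K) fun k hk => ?_
    have hkN : N ≤ s k := by exact_mod_cast hK k (by simpa using hk)
    rw [freq_eq_of_injective ((h k).1.trans (min_eq_right hkN)) (hω k)]
    simp

/-! ### The BFGS update, the Byrd-Nocedal potential and the Dennis-Moré condition. -/

section BFGS

variable {n : ℕ} {Λ A : Matrix (Fin n) (Fin n) ℝ} {u v w : Fin n → ℝ}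

theorem dotProduct_mulVec_pos (hA : A.PosDef) (hu : u ≠ 0) : 0 < u ⬝ᵥ A *ᵥ u := by
  simpa using hA.dotProduct_mulVec_pos hu

theorem dotProduct_mulVec_symm (hA : A.PosDef) (u v : Fin n → ℝ) :
    u ⬝ᵥ A *ᵥ v = v ⬝ᵥ A *ᵥ u := by
  have h : Aᵀ = A := by simpa using hA.isHermitian.eq
  rw [Matrix.dotProduct_mulVec, ← Matrix.mulVec_transpose, h, dotProduct_comm]

theorem inv_mulVec_mulVec (hA : A.PosDef) (u : Fin n → ℝ) : A⁻¹ *ᵥ A *ᵥ u = u := by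
  rw [Matrix.mulVec_mulVec, Matrix.nonsing_inv_mul _ hA.det_pos.ne'.isUnit, Matrix.one_mulVec]

/-- The quadratic form of `A⁻¹` at `x + t A u`. -/
theorem inv_quadratic_add_smul (hA : A.PosDef) (u x : Fin n → ℝ) (t : ℝ) :
    (x + t • A *ᵥ u) ⬝ᵥ A⁻¹ *ᵥ (x + t • A *ᵥ u)
      = x ⬝ᵥ A⁻¹ *ᵥ x + 2 * t * (u ⬝ᵥ x) + t ^ 2 * (u ⬝ᵥ A *ᵥ u) := by
  have h1 : A *ᵥ u ⬝ᵥ A⁻¹ *ᵥ x = u ⬝ᵥ x := by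
    rw [dotProduct_mulVec_symm hA.inv, inv_mulVec_mulVec hA, dotProduct_comm]
  simp only [Matrix.mulVec_add, Matrix.mulVec_smul, inv_mulVec_mulVec hA, dotProduct_add,
    add_dotProduct, dotProduct_smul, smul_dotProduct, smul_eq_mul, h1]
  rw [dotProduct_comm x u, dotProduct_comm (A *ᵥ u) u]
  ring

/-- The Cauchy-Schwarz inequality for the dual norms given by `A` and `A⁻¹`. -/
theorem sq_dotProduct_le (hA : A.PosDef) (u x : Fin n → ℝ) :
    (u ⬝ᵥ x) ^ 2 ≤ (u ⬝ᵥ A *ᵥ u) * (x ⬝ᵥ A⁻¹ *ᵥ x) := by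
  rcases eq_or_ne u 0 with rfl | hu
  · simp
  have hα := dotProduct_mulVec_pos hA hu
  -- This value of `t` minimizes the quadratic form of `A⁻¹` along `x + t A u`; the inequality says
  -- that the minimum is nonnegative.
  have h := hA.inv.posSemidef.dotProduct_mulVec_nonneg
    (x + (-((u ⬝ᵥ x) / (u ⬝ᵥ A *ᵥ u))) • A *ᵥ u)
  rw [star_trivial, inv_quadratic_add_smul hA] at h
  have h2 : x ⬝ᵥ A⁻¹ *ᵥ x + 2 * (-((u ⬝ᵥ x) / (u ⬝ᵥ A *ᵥ u))) * (u ⬝ᵥ x)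
      + (-((u ⬝ᵥ x) / (u ⬝ᵥ A *ᵥ u))) ^ 2 * (u ⬝ᵥ A *ᵥ u)
      = x ⬝ᵥ A⁻¹ *ᵥ x - (u ⬝ᵥ x) ^ 2 / (u ⬝ᵥ A *ᵥ u) := by
    field_simp
    ring
  rw [h2, sub_nonneg, div_le_iff₀ hα] at h
  linarith

/-- The factor `F` of the product form `F Λ Fᵀ` of the BFGS update. -/
noncomputable def bfgsFactor (Λ : Matrix (Fin n) (Fin n) ℝ) (u v : Fin n → ℝ) :
    Matrix (Fin n) (Fin n) ℝ :=
  1 + Matrix.vecMulVec ((u ⬝ᵥ Λ *ᵥ u)⁻¹ •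
    (√((u ⬝ᵥ Λ *ᵥ u) / (u ⬝ᵥ v)) • v - Λ *ᵥ u)) u

/-- In the expansion the mixed terms in `v` and `Λ u` cancel. The product form reduces positivity
and the determinant to a rank-one perturbation of the identity. -/
theorem bfgs_eq_bfgsFactor (hΛ : Λ.PosDef) (huv : 0 < u ⬝ᵥ v) :
    bfgs Λ u v = bfgsFactor Λ u v * Λ * (bfgsFactor Λ u v)ᵀ := by
  have hu : u ≠ 0 := by
    rintro rfl
    simp at huv
  have hβ := dotProduct_mulVec_pos hΛ hu
  have hsq : √((u ⬝ᵥ Λ *ᵥ u) / (u ⬝ᵥ v)) ^ 2 = (u ⬝ᵥ Λ *ᵥ u) / (u ⬝ᵥ v) :=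
    Real.sq_sqrt (by positivity)
  have hsymm : Λᵀ = Λ := by simpa using hΛ.isHermitian.eq
  have hvec : u ᵥ* Λ = Λ *ᵥ u := by
    rw [← Matrix.mulVec_transpose, hsymm]
  unfold bfgs bfgsFactor
  set β := u ⬝ᵥ Λ *ᵥ u
  set q := √(β / (u ⬝ᵥ v))
  have hq : (u ⬝ᵥ v)⁻¹ = β⁻¹ * q ^ 2 := by
    rw [hsq]
    field_simp
  rw [hq, Matrix.transpose_add, Matrix.transpose_one, Matrix.transpose_vecMulVec,
    Matrix.mul_vecMulVec, Matrix.vecMulVec_mul, hvec, Matrix.add_mul, Matrix.one_mul,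
    Matrix.vecMulVec_mul, hvec, Matrix.mul_add,
    Matrix.mul_one, Matrix.add_mul, Matrix.mul_vecMulVec, Matrix.vecMulVec_mul_vecMulVec]
  have hβ' : Λ *ᵥ u ⬝ᵥ u = β := dotProduct_comm _ _
  rw [hβ']
  ext a b
  simp only [Matrix.add_apply, Matrix.sub_apply, Matrix.smul_apply, Matrix.vecMulVec_apply,
    Pi.smul_apply, Pi.sub_apply, smul_eq_mul]
  field_simp
  ring

theorem det_bfgsFactor (hΛ : Λ.PosDef) (huv : 0 < u ⬝ᵥ v) :
    (bfgsFactor Λ u v).det ^ 2 = (u ⬝ᵥ v) / (u ⬝ᵥ Λ *ᵥ u) := by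
  have hu : u ≠ 0 := by
    rintro rfl
    simp at huv
  have hβ := dotProduct_mulVec_pos hΛ hu
  have hsq : √((u ⬝ᵥ Λ *ᵥ u) / (u ⬝ᵥ v)) ^ 2 = (u ⬝ᵥ Λ *ᵥ u) / (u ⬝ᵥ v) :=
    Real.sq_sqrt (by positivity)
  have hdet : (bfgsFactor Λ u v).det
      = √((u ⬝ᵥ Λ *ᵥ u) / (u ⬝ᵥ v)) * (u ⬝ᵥ v) / (u ⬝ᵥ Λ *ᵥ u) := by
    rw [bfgsFactor, Matrix.vecMulVec_eq Unit, Matrix.det_one_add_replicateCol_mul_replicateRow,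
      dotProduct_smul, dotProduct_sub, dotProduct_smul, smul_eq_mul, smul_eq_mul]
    field_simp
    ring
  rw [hdet, div_pow, mul_pow, hsq]
  field_simp

theorem bfgs_posDef (hΛ : Λ.PosDef) (huv : 0 < u ⬝ᵥ v) : (bfgs Λ u v).PosDef := by
  have hu : u ≠ 0 := by
    rintro rfl
    simp at huv
  have hβ := dotProduct_mulVec_pos hΛ hu
  have hdet : (bfgsFactor Λ u v).det ≠ 0 := by
    intro h
    have := det_bfgsFactor hΛ huv
    rw [h] at this
    have h2 : 0 < (u ⬝ᵥ v) / (u ⬝ᵥ Λ *ᵥ u) := by positivity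
    rw [← this] at h2
    simp at h2
  rw [bfgs_eq_bfgsFactor hΛ huv, ← Matrix.conjTranspose_eq_transpose_of_trivial]
  refine hΛ.mul_mul_conjTranspose_same ?_
  exact Matrix.vecMul_injective_of_isUnit ((Matrix.isUnit_iff_isUnit_det _).mpr hdet.isUnit)

theorem det_bfgs (hΛ : Λ.PosDef) (huv : 0 < u ⬝ᵥ v) :
    (bfgs Λ u v).det = Λ.det * ((u ⬝ᵥ v) / (u ⬝ᵥ Λ *ᵥ u)) := by
  rw [bfgs_eq_bfgsFactor hΛ huv, Matrix.det_mul, Matrix.det_mul, Matrix.det_transpose,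
    ← det_bfgsFactor hΛ huv]
  ring

/-- The Byrd-Nocedal potential of `Λ` relative to `A`. -/
noncomputable def potential (A Λ : Matrix (Fin n) (Fin n) ℝ) : ℝ :=
  (A⁻¹ * Λ).trace - Real.log Λ.det

theorem trace_sub_log_det_nonneg {M : Matrix (Fin n) (Fin n) ℝ} (hM : M.PosSemidef)
    (hdet : M.det ≠ 0) : 0 ≤ M.trace - Real.log M.det := by
  have h1 := hM.isHermitian.trace_eq_sum_eigenvalues
  have h2 := hM.isHermitian.det_eq_prod_eigenvalues
  simp only [RCLike.ofReal_real_eq_id, id] at h1 h2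
  rw [h2, Finset.prod_ne_zero_iff] at hdet
  rw [h1, h2, Real.log_prod hdet, ← Finset.sum_sub_distrib]
  exact Finset.sum_nonneg fun i _ => sub_nonneg.mpr (Real.log_le_self (hM.eigenvalues_nonneg i))

open scoped MatrixOrder in
-- With `A⁻¹ = Cᴴ C`, the matrix `C Λ Cᴴ` has the trace of `A⁻¹ Λ` and determinant `det A⁻¹ · det
-- Λ`; each of its eigenvalues satisfies `log x ≤ x`.
theorem potential_ge (hA : A.PosDef) (hΛ : Λ.PosDef) : Real.log (A⁻¹).det ≤ potential A Λ := by
  obtain ⟨C, hC⟩ := CStarAlgebra.nonneg_iff_eq_star_mul_self.mp hA.inv.posSemidef.nonneg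
  rw [Matrix.star_eq_conjTranspose] at hC
  have hdet : (A⁻¹).det = C.det * C.det := by
    rw [hC, Matrix.det_mul, Matrix.conjTranspose_eq_transpose_of_trivial, Matrix.det_transpose]
  have hA' : 0 < (A⁻¹).det := hA.inv.det_pos
  have hM : (C * Λ * Cᴴ).det = (A⁻¹).det * Λ.det := by
    rw [hdet, Matrix.det_mul, Matrix.det_mul, Matrix.conjTranspose_eq_transpose_of_trivial,
      Matrix.det_transpose]
    ring
  have hne : (C * Λ * Cᴴ).det ≠ 0 := by
    rw [hM]
    exact (mul_pos hA' hΛ.det_pos).ne'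
  have h := trace_sub_log_det_nonneg (hΛ.posSemidef.mul_mul_conjTranspose_same C) hne
  rw [hM, Real.log_mul hA'.ne' hΛ.det_pos.ne', Matrix.trace_mul_comm, ← Matrix.mul_assoc, ← hC]
    at h
  unfold potential
  linarith

theorem potential_bfgs (hΛ : Λ.PosDef) (huv : 0 < u ⬝ᵥ v) :
    potential A (bfgs Λ u v) = potential A Λ
      - (Λ *ᵥ u ⬝ᵥ A⁻¹ *ᵥ Λ *ᵥ u) / (u ⬝ᵥ Λ *ᵥ u) + (v ⬝ᵥ A⁻¹ *ᵥ v) / (u ⬝ᵥ v)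
      - Real.log ((u ⬝ᵥ v) / (u ⬝ᵥ Λ *ᵥ u)) := by
  have hu : u ≠ 0 := by
    rintro rfl
    simp at huv
  have hβ := dotProduct_mulVec_pos hΛ hu
  have hsymm : Λᵀ = Λ := by simpa using hΛ.isHermitian.eq
  have hvec : u ᵥ* Λ = Λ *ᵥ u := by
    rw [← Matrix.mulVec_transpose, hsymm]
  unfold potential
  rw [det_bfgs hΛ huv, Real.log_mul hΛ.det_pos.ne' (by positivity), bfgs, Matrix.mul_vecMulVec,
    Matrix.vecMulVec_mul, hvec, Matrix.mul_add, Matrix.mul_sub, Matrix.mul_smul, Matrix.mul_smul,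
    Matrix.mul_vecMulVec, Matrix.mul_vecMulVec, Matrix.trace_add, Matrix.trace_sub,
    Matrix.trace_smul, Matrix.trace_smul, Matrix.trace_vecMulVec, Matrix.trace_vecMulVec,
    dotProduct_comm (A⁻¹ *ᵥ v), dotProduct_comm (A⁻¹ *ᵥ Λ *ᵥ u)]
  simp only [smul_eq_mul]
  ring

/-- The error `2 δ` is quadratic in `w`. With `e` the relative change of `u ⬝ᵥ v` and `ρ` that of
`w` in squared dual norm, the trace and logarithm terms together cost at most `ρ / (1 + e)`, with no
term linear in `e`. -/
theorem potential_bfgs_le (hA : A.PosDef) (hΛ : Λ.PosDef) (hu : u ≠ 0) {δ : ℝ} (hδ : δ ≤ 1 / 4)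
    (hw : w ⬝ᵥ A⁻¹ *ᵥ w ≤ δ * (u ⬝ᵥ A *ᵥ u)) :
    0 < u ⬝ᵥ (A *ᵥ u + w) ∧ potential A (bfgs Λ u (A *ᵥ u + w)) ≤ potential A Λ
      - ((Λ *ᵥ u ⬝ᵥ A⁻¹ *ᵥ Λ *ᵥ u) / (u ⬝ᵥ Λ *ᵥ u) - 1
        - Real.log ((u ⬝ᵥ Λ *ᵥ u) / (u ⬝ᵥ A *ᵥ u))) + 2 * δ := by
  have hα := dotProduct_mulVec_pos hA hu
  have hβ := dotProduct_mulVec_pos hΛ hu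
  have hcs := sq_dotProduct_le hA u w
  have hvv := inv_quadratic_add_smul hA u w 1
  have huv : u ⬝ᵥ (A *ᵥ u + w) = u ⬝ᵥ A *ᵥ u + u ⬝ᵥ w := dotProduct_add _ _ _
  rw [one_smul, add_comm w] at hvv
  obtain ⟨e, he⟩ : ∃ e, u ⬝ᵥ w = (u ⬝ᵥ A *ᵥ u) * e :=
    ⟨(u ⬝ᵥ w) / (u ⬝ᵥ A *ᵥ u), by field_simp⟩
  obtain ⟨ρ, hρ⟩ : ∃ ρ, w ⬝ᵥ A⁻¹ *ᵥ w = ρ * (u ⬝ᵥ A *ᵥ u) :=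
    ⟨(w ⬝ᵥ A⁻¹ *ᵥ w) / (u ⬝ᵥ A *ᵥ u), by field_simp⟩
  rw [hρ] at hw hcs hvv
  rw [he] at hcs hvv huv
  have hρδ : ρ ≤ δ := le_of_mul_le_mul_right hw hα
  have heρ : e ^ 2 ≤ ρ := by
    have : (u ⬝ᵥ A *ᵥ u) ^ 2 * e ^ 2 ≤ (u ⬝ᵥ A *ᵥ u) ^ 2 * ρ := by nlinarith
    exact le_of_mul_le_mul_left this (by positivity)
  -- From `e² ≤ ρ ≤ δ ≤ 1/4`.
  have he2 : (1 / 2 : ℝ) ≤ 1 + e := by nlinarith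
  have he0 : 0 < 1 + e := by linarith
  have hpos : 0 < u ⬝ᵥ (A *ᵥ u + w) := by
    rw [huv]
    nlinarith
  refine ⟨hpos, ?_⟩
  rw [potential_bfgs hΛ hpos, hvv, huv]
  set α := u ⬝ᵥ A *ᵥ u
  set β := u ⬝ᵥ Λ *ᵥ u
  have hlog : Real.log ((α + α * e) / β) = Real.log (1 + e) - Real.log (β / α) := by
    rw [← Real.log_div he0.ne' (by positivity)]
    congr 1
    field_simp
  have hlog2 : 1 - (1 + e)⁻¹ ≤ Real.log (1 + e) := Real.one_sub_inv_le_log_of_pos he0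
  have hT : (ρ * α + 2 * 1 * (α * e) + 1 ^ 2 * α) / (α + α * e) - 1 - (1 - (1 + e)⁻¹) ≤ 2 * δ := by
    have : (ρ * α + 2 * 1 * (α * e) + 1 ^ 2 * α) / (α + α * e) - 1 - (1 - (1 + e)⁻¹)
        = ρ / (1 + e) := by
      have : α + α * e ≠ 0 := by nlinarith
      field_simp
      ring
    rw [this, div_le_iff₀ he0]
    nlinarith
  rw [hlog]
  linarith

theorem sq_sqrt_sub_one_le {a : ℝ} (ha : 0 < a) : (√a - 1) ^ 2 ≤ a - 1 - Real.log a := by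
  have h1 : Real.log a = 2 * Real.log √a := by
    rw [Real.log_sqrt ha.le]
    ring
  have h2 := Real.log_le_sub_one_of_pos (Real.sqrt_pos.mpr ha)
  nlinarith [Real.sq_sqrt ha.le]

theorem tendsto_one_of_sub_log {a h : ℕ → ℝ} (ha : ∀ k, 0 < a k) (hh : Tendsto h atTop (𝓝 0))
    (hle : ∀ k, a k - 1 - Real.log (a k) ≤ h k) : Tendsto a atTop (𝓝 1) := by
  have h1 : Tendsto (fun k => (√(a k) - 1) ^ 2) atTop (𝓝 0) :=
    squeeze_zero (fun _ => sq_nonneg _) (fun k => (sq_sqrt_sub_one_le (ha k)).trans (hle k)) hh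
  have h2 : Tendsto (fun k => √(a k) - 1) atTop (𝓝 0) := by
    rw [tendsto_zero_iff_abs_tendsto_zero]
    simpa [Function.comp_def, Real.sqrt_sq_eq_abs] using h1.sqrt
  have h3 := (h2.add_const 1).pow 2
  simpa [Real.sq_sqrt (ha _).le] using h3

theorem summable_of_potential {ψ h δ : ℕ → ℝ} {m : ℝ} (hh : ∀ k, 0 ≤ h k) (hδ0 : ∀ k, 0 ≤ δ k)
    (hδ : Summable δ) (hm : ∀ k, m ≤ ψ k) (hstep : ∀ k, ψ (k + 1) ≤ ψ k - h k + δ k) :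
    Summable h := by
  refine summable_of_sum_range_le (c := ψ 0 - m + ∑' k, δ k) hh fun K => ?_
  have h1 : ∑ k ∈ Finset.range K, h k ≤ ψ 0 - ψ K + ∑ k ∈ Finset.range K, δ k := by
    induction K with
    | zero => simp
    | succ K ih =>
      rw [Finset.sum_range_succ, Finset.sum_range_succ]
      linarith [hstep K]
  linarith [hm K, hδ.sum_le_tsum (Finset.range K) fun k _ => hδ0 k]

/-- The Dennis-Moré condition for the BFGS method, in the norm dual to that of `A`. -/
theorem tendsto_bfgs_residual (hA : A.PosDef) {Λ : ℕ → Matrix (Fin n) (Fin n) ℝ}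
    {u w : ℕ → Fin n → ℝ} (hΛ : (Λ 0).PosDef) (hu : ∀ k, u k ≠ 0)
    (hstep : ∀ k, 0 < u k ⬝ᵥ (A *ᵥ u k + w k) →
      Λ (k + 1) = bfgs (Λ k) (u k) (A *ᵥ u k + w k))
    {δ : ℕ → ℝ} (hδ0 : ∀ k, 0 ≤ δ k) (hδ4 : ∀ k, δ k ≤ 1 / 4) (hδ : Summable δ)
    (hw : ∀ k, w k ⬝ᵥ A⁻¹ *ᵥ w k ≤ δ k * (u k ⬝ᵥ A *ᵥ u k)) :
    Tendsto (fun k => ((Λ k - A) *ᵥ u k ⬝ᵥ A⁻¹ *ᵥ (Λ k - A) *ᵥ u k) / (u k ⬝ᵥ A *ᵥ u k))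
      atTop (𝓝 0) := by
  have hpos k : (Λ k).PosDef := by
    induction k with
    | zero => exact hΛ
    | succ k ih =>
      have h := (potential_bfgs_le hA ih (hu k) (hδ4 k) (hw k)).1
      rw [hstep k h]
      exact bfgs_posDef ih h
  have hα k := dotProduct_mulVec_pos hA (hu k)
  have hβ k := dotProduct_mulVec_pos (hpos k) (hu k)
  set α := fun k => u k ⬝ᵥ A *ᵥ u k with hαdef
  set β := fun k => u k ⬝ᵥ Λ k *ᵥ u k with hβdef
  set γ := fun k => Λ k *ᵥ u k ⬝ᵥ A⁻¹ *ᵥ Λ k *ᵥ u k with hγdef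
  have hcs k : β k / α k ≤ γ k / β k := by
    rw [div_le_div_iff₀ (hα k) (hβ k)]
    have := sq_dotProduct_le hA (u k) (Λ k *ᵥ u k)
    simp only [hβdef, hγdef]
    nlinarith
  have hc k : 0 < β k / α k := div_pos (hβ k) (hα k)
  have ha k : 0 < γ k / β k := (hc k).trans_le (hcs k)
  have hlog k : Real.log (β k / α k) ≤ Real.log (γ k / β k) := Real.log_le_log (hc k) (hcs k)
  have hh : Summable fun k => γ k / β k - 1 - Real.log (β k / α k) := by
    refine summable_of_potential (ψ := fun k => potential A (Λ k)) (δ := fun k => 2 * δ k)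
      (m := Real.log (A⁻¹).det) (fun k => ?_) (fun k => by linarith [hδ0 k]) (hδ.mul_left 2)
      (fun k => potential_ge hA (hpos k)) fun k => ?_
    · linarith [hcs k, Real.log_le_sub_one_of_pos (hc k)]
    · have h := potential_bfgs_le hA (hpos k) (hu k) (hδ4 k) (hw k)
      rw [hstep k h.1]
      exact h.2
  have h0 := hh.tendsto_atTop_zero
  -- Put `a = γ/β` and `c = β/α`. Since `c ≤ a`, the summable quantity `a - 1 - log c` dominates
  -- both `a - 1 - log a` and `c - 1 - log c`.
  have ha1 := tendsto_one_of_sub_log ha h0 fun k => by linarith [hlog k]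
  have hc1 := tendsto_one_of_sub_log hc h0 fun k => by linarith [hcs k]
  have hlim := ((ha1.mul hc1).sub (hc1.const_mul 2)).add_const 1
  norm_num at hlim
  refine hlim.congr fun k => ?_
  -- Taking `t = -1` turns the squared dual norm of `(Λ - A) u` into `γ - 2β + α`, which divided by
  -- `α` is `a c - 2 c + 1`.
  have hD := inv_quadratic_add_smul hA (u k) (Λ k *ᵥ u k) (-1)
  rw [neg_one_smul, ← sub_eq_add_neg, ← Matrix.sub_mulVec] at hD
  rw [hD]
  change γ k / β k * (β k / α k) - 2 * (β k / α k) + 1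
    = (γ k + 2 * (-1) * β k + (-1) ^ 2 * α k) / α k
  have : α k ≠ 0 := (hα k).ne'
  have : β k ≠ 0 := (hβ k).ne'
  field_simp
  ring

theorem generatedByBFGS_posDef {Λ : ℕ → Matrix (Fin n) (Fin n) ℝ} {u v : ℕ → Fin n → ℝ}
    (h : GeneratedByBFGS Λ u v) (k : ℕ) : (Λ k).PosDef := by
  induction k with
  | zero => exact h.1
  | succ k ih =>
    by_cases huv : 0 < u k ⬝ᵥ v k
    · rw [(h.2 k).1 huv]
      exact bfgs_posDef ih huv
    · exact (h.2 k).2 huv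

theorem quadratic_le (M : Matrix (Fin n) (Fin n) ℝ) (x : Vec n) :
    x.ofLp ⬝ᵥ M *ᵥ x.ofLp ≤ ‖M‖ * ‖x‖ ^ 2 := by
  rw [← Matrix.inner_toEuclideanCLM]
  calc _ ≤ ‖x‖ * ‖Matrix.toEuclideanCLM (𝕜 := ℝ) M x‖ := real_inner_le_norm _ _
    _ ≤ ‖x‖ * (‖M‖ * ‖x‖) := by
      gcongr
      exact (Matrix.toEuclideanCLM (𝕜 := ℝ) M).le_opNorm x
    _ = _ := by ring

theorem sq_norm_le (hA : A.PosDef) (x : Vec n) :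
    ‖x‖ ^ 2 ≤ ‖A⁻¹‖ * (x.ofLp ⬝ᵥ A *ᵥ x.ofLp) := by
  rcases eq_or_ne x 0 with rfl | hx
  · simp
  have hn : 0 < ‖x‖ ^ 2 := by positivity
  have h1 := sq_dotProduct_le hA x.ofLp x.ofLp
  have h2 : x.ofLp ⬝ᵥ x.ofLp = ‖x‖ ^ 2 := by
    rw [EuclideanSpace.real_norm_sq_eq]
    simp [dotProduct, sq]
  have h3 : 0 ≤ x.ofLp ⬝ᵥ A *ᵥ x.ofLp := by
    simpa using hA.posSemidef.dotProduct_mulVec_nonneg x.ofLp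
  rw [h2] at h1
  have h4 := mul_le_mul_of_nonneg_left (quadratic_le A⁻¹ x) h3
  refine le_of_mul_le_mul_right ?_ hn
  linarith

/-- The Dennis-Moré condition for the BFGS method when the secant vectors are square summable
relative perturbations of `A u_k`. -/
theorem bfgs_isLittleO (hA : A.PosDef) {Λ : ℕ → Matrix (Fin n) (Fin n) ℝ} {u : ℕ → Vec n}
    {v : ℕ → Fin n → ℝ} (h : GeneratedByBFGS Λ (fun k => (u k).ofLp) v)
    (hu : ∀ᶠ k in atTop, u k ≠ 0) {ε : ℕ → ℝ} (hε : Summable fun k => ε k ^ 2)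
    (hv : ∀ᶠ k in atTop,
      ‖WithLp.toLp 2 (v k) - Matrix.toEuclideanCLM (𝕜 := ℝ) A (u k)‖ ≤ ε k * ‖u k‖) :
    (fun k => Matrix.toEuclideanCLM (𝕜 := ℝ) (Λ k - A) (u k)) =o[atTop] u := by
  -- One factor `‖A⁻¹‖` bounds the dual norm of the error, the other compares `‖u‖²` with the form
  -- of `A`.
  have hδ : Summable fun k => ‖A⁻¹‖ ^ 2 * ε k ^ 2 := hε.mul_left _
  have hδ4 : ∀ᶠ k in atTop, ‖A⁻¹‖ ^ 2 * ε k ^ 2 ≤ 1 / 4 :=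
    hδ.tendsto_atTop_zero.eventually_le_const (by norm_num)
  -- The bounds hold only from some `K` on; the method may be restarted there because every `Λ k` is
  -- positive definite.
  obtain ⟨K, hK⟩ := eventually_atTop.mp ((hu.and hv).and hδ4)
  have hu0 k : (u (k + K)).ofLp ≠ 0 := by
    have := (hK (k + K) (by omega)).1.1
    simpa using this
  have hlim := tendsto_bfgs_residual hA (Λ := fun k => Λ (k + K))
    (u := fun k => (u (k + K)).ofLp) (w := fun k => v (k + K) - A *ᵥ (u (k + K)).ofLp)
    (δ := fun k => ‖A⁻¹‖ ^ 2 * ε (k + K) ^ 2) (generatedByBFGS_posDef h _) hu0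
    (fun k hk => by
      simp only [add_sub_cancel] at hk ⊢
      rw [add_right_comm]
      exact (h.2 (k + K)).1 hk)
    (fun k => by positivity) (fun k => (hK (k + K) (by omega)).2)
    ((summable_nat_add_iff K).mpr hδ) (fun k => by
      have h1 := (hK (k + K) (by omega)).1.2
      have h2 := quadratic_le A⁻¹
        (WithLp.toLp 2 (v (k + K)) - Matrix.toEuclideanCLM (𝕜 := ℝ) A (u (k + K)))
      have h3 := sq_norm_le hA (u (k + K))
      have h4 := pow_le_pow_left₀ (norm_nonneg _) h1 2
      refine h2.trans ?_
      calc _ ≤ ‖A⁻¹‖ * (ε (k + K) * ‖u (k + K)‖) ^ 2 := by gcongr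
        _ = ‖A⁻¹‖ * ε (k + K) ^ 2 * ‖u (k + K)‖ ^ 2 := by ring
        _ ≤ ‖A⁻¹‖ * ε (k + K) ^ 2 *
            (‖A⁻¹‖ * ((u (k + K)).ofLp ⬝ᵥ A *ᵥ (u (k + K)).ofLp)) := by gcongr
        _ = _ := by ring)
  rw [tendsto_add_atTop_iff_nat (f := fun k =>
    ((Λ k - A) *ᵥ (u k).ofLp ⬝ᵥ A⁻¹ *ᵥ (Λ k - A) *ᵥ (u k).ofLp)
      / ((u k).ofLp ⬝ᵥ A *ᵥ (u k).ofLp)) K] at hlim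
  have hlim2 := hlim.const_mul (‖A‖ * ‖A‖)
  rw [mul_zero] at hlim2
  rw [isLittleO_iff]
  intro c hc
  filter_upwards [hlim2.eventually_le_const (show 0 < c ^ 2 by positivity), hu] with k hk huk
  have huk' : (u k).ofLp ≠ 0 := by simpa using huk
  have hα := dotProduct_mulVec_pos hA huk'
  have h1 := sq_norm_le hA.inv (Matrix.toEuclideanCLM (𝕜 := ℝ) (Λ k - A) (u k))
  rw [Matrix.nonsing_inv_nonsing_inv _ hA.det_pos.ne'.isUnit] at h1
  have h2 := quadratic_le A (u k)
  refine (sq_le_sq₀ (norm_nonneg _) (by positivity)).mp ?_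
  set D := (Matrix.toEuclideanCLM (𝕜 := ℝ) (Λ k - A) (u k)).ofLp ⬝ᵥ
    A⁻¹ *ᵥ (Matrix.toEuclideanCLM (𝕜 := ℝ) (Λ k - A) (u k)).ofLp
  have hk' : ‖A‖ * ‖A‖ * (D / ((u k).ofLp ⬝ᵥ A *ᵥ (u k).ofLp)) ≤ c ^ 2 := hk
  have hD : 0 ≤ D := by simpa using hA.inv.posSemidef.dotProduct_mulVec_nonneg _
  calc _ ≤ ‖A‖ * D := h1
    _ = ‖A‖ * (D / ((u k).ofLp ⬝ᵥ A *ᵥ (u k).ofLp)) * ((u k).ofLp ⬝ᵥ A *ᵥ (u k).ofLp) := by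
      field_simp
    _ ≤ ‖A‖ * (D / ((u k).ofLp ⬝ᵥ A *ᵥ (u k).ofLp)) * (‖A‖ * ‖u k‖ ^ 2) := by gcongr
    _ = ‖A‖ * ‖A‖ * (D / ((u k).ofLp ⬝ᵥ A *ᵥ (u k).ofLp)) * ‖u k‖ ^ 2 := by ring
    _ ≤ c ^ 2 * ‖u k‖ ^ 2 := by gcongr
    _ = _ := by ring

end BFGS

/-! ### Derivatives of the objective and linearization of the secant terms. -/

section Calculus

theorem gradient_apply {d : ℕ} (g : Vec d → ℝ) (x : Vec d) (a : Fin d) :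
    gradient g x a = fderiv ℝ g x (EuclideanSpace.single a 1) := by
  rw [← inner_gradient_left, EuclideanSpace.inner_single_right]
  simp

theorem sum_smul_single {d : ℕ} (e : Vec d) :
    ∑ a, e a • EuclideanSpace.single a (1 : ℝ) = e := by
  ext b
  simp [Finset.sum_apply, Pi.single_apply]

/-- Symmetry of the second derivative, valid without its continuity, lets row `a` of `hessian`
represent the derivative of the `a`-th partial derivative. -/
theorem hasFDerivAt_gradient {d : ℕ} {g : Vec d → ℝ} (hg : TwiceDifferentiable g) (x : Vec d) :
    HasFDerivAt (gradient g) (Matrix.toEuclideanCLM (𝕜 := ℝ) (hessian g x)) x := by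
  have hx : HasFDerivAt (fderiv ℝ g) (fderiv ℝ (fderiv ℝ g) x) x := (hg.2 x).hasFDerivAt
  have hsymm := second_derivative_symmetric (fun y => (hg.1 y).hasFDerivAt) hx
  rw [← hasFDerivWithinAt_univ, hasFDerivWithinAt_euclidean]
  intro a
  rw [hasFDerivWithinAt_univ]
  have h1 := hx.clm_apply (hasFDerivAt_const (EuclideanSpace.single a (1 : ℝ)) x)
  simp only [gradient_apply]
  refine h1.congr_fderiv ?_
  ext e
  have h2 : fderiv ℝ (fderiv ℝ g) x (EuclideanSpace.single a 1) e
      = ∑ b, hessian g x a b * e b := by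
    conv_lhs => rw [← sum_smul_single e]
    simp [hessian, mul_comm]
  simp only [ContinuousLinearMap.comp_zero, zero_add]
  simp only [ContinuousLinearMap.flip_apply, hsymm e, h2]
  rfl

variable {N n m : ℕ} {f : Fin N → Vec n → Vec m} {ℓ : Fin N → Vec m → ℝ}

theorem hasFDerivAt_model (hf : ∀ i j, TwiceDifferentiable fun t => f i t j) (i : Fin N)
    (θ : Vec n) : HasFDerivAt (f i) (fderiv ℝ (f i) θ) θ :=
  ((differentiableAt_euclidean).mpr fun j => (hf i j).1 θ).hasFDerivAt

theorem fderiv_model_apply (hf : ∀ i j, TwiceDifferentiable fun t => f i t j) (i : Fin N)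
    (θ e : Vec n) (j : Fin m) :
    fderiv ℝ (f i) θ e j = inner ℝ (gradient (fun t => f i t j) θ) e := by
  have h : HasFDerivAt (fun t => f i t j)
      ((EuclideanSpace.proj (𝕜 := ℝ) j).comp (fderiv ℝ (f i) θ)) θ :=
    (EuclideanSpace.proj (𝕜 := ℝ) j).hasFDerivAt.comp θ (hasFDerivAt_model hf i θ)
  rw [inner_gradient_left, h.fderiv]
  rfl

theorem hasGradientAt_objective (hf : ∀ i j, TwiceDifferentiable fun t => f i t j)
    (hℓ : ∀ i, TwiceDifferentiable (ℓ i)) (θ : Vec n) :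
    HasGradientAt (objective f ℓ) ((N : ℝ)⁻¹ • ∑ i, ∑ j,
      gradient (ℓ i) (f i θ) j • gradient (fun t => f i t j) θ) θ := by
  rw [hasGradientAt_iff_hasFDerivAt]
  have h1 i : HasFDerivAt (fun t => ℓ i (f i t))
      ((fderiv ℝ (ℓ i) (f i θ)).comp (fderiv ℝ (f i) θ)) θ :=
    ((hℓ i).1 _).hasFDerivAt.comp θ (hasFDerivAt_model hf i θ)
  refine ((HasFDerivAt.fun_sum fun i _ => h1 i).const_mul (N : ℝ)⁻¹).congr_fderiv ?_
  ext e
  simp only [smul_apply, sum_apply,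
    InnerProductSpace.toDual_apply_apply, inner_smul_left, sum_inner,
    ContinuousLinearMap.comp_apply, ← fderiv_model_apply hf, smul_eq_mul]
  congr 1
  refine Finset.sum_congr rfl fun i _ => ?_
  rw [← inner_gradient_left]
  simp only [PiLp.inner_apply]
  simp [mul_comm]

theorem gradient_objective (hf : ∀ i j, TwiceDifferentiable fun t => f i t j)
    (hℓ : ∀ i, TwiceDifferentiable (ℓ i)) (θ : Vec n) :
    gradient (objective f ℓ) θ = (N : ℝ)⁻¹ • ∑ i, ∑ j,
      gradient (ℓ i) (f i θ) j • gradient (fun t => f i t j) θ :=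
  (hasGradientAt_objective hf hℓ θ).gradient

theorem hasFDerivAt_lossGradient (hf : ∀ i j, TwiceDifferentiable fun t => f i t j)
    (hℓ : ∀ i, TwiceDifferentiable (ℓ i)) (i : Fin N) (j : Fin m) (θ : Vec n) :
    HasFDerivAt (fun t => gradient (ℓ i) (f i t) j)
      ((EuclideanSpace.proj j).comp ((Matrix.toEuclideanCLM (𝕜 := ℝ) (hessian (ℓ i) (f i θ))).comp
        (fderiv ℝ (f i) θ))) θ :=
  (EuclideanSpace.proj (𝕜 := ℝ) j).hasFDerivAt.comp θ
    ((hasFDerivAt_gradient (hℓ i) _).comp θ (hasFDerivAt_model hf i θ))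

theorem toEuclideanCLM_residual (i : Fin N) (θ e : Vec n) :
    Matrix.toEuclideanCLM (𝕜 := ℝ) (residual f ℓ i θ) e = ∑ j, gradient (ℓ i) (f i θ) j •
      Matrix.toEuclideanCLM (𝕜 := ℝ) (hessian (fun t => f i t j) θ) e := by
  simp [residual, map_sum]

theorem toEuclideanCLM_ggn (hf : ∀ i j, TwiceDifferentiable fun t => f i t j) (i : Fin N)
    (θ e : Vec n) :
    Matrix.toEuclideanCLM (𝕜 := ℝ) (ggn f ℓ i θ) e = ∑ j,
      (Matrix.toEuclideanCLM (𝕜 := ℝ) (hessian (ℓ i) (f i θ)) (fderiv ℝ (f i) θ e)) j •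
        gradient (fun t => f i t j) θ := by
  have h : (jac (f i) θ)ᵀ *ᵥ e.ofLp = (fderiv ℝ (f i) θ e).ofLp := by
    ext j
    rw [fderiv_model_apply hf]
    simp only [PiLp.inner_apply]
    simp [Matrix.mulVec, dotProduct, jac, mul_comm]
  ext a
  simp only [Matrix.ofLp_toEuclideanCLM, ggn]
  rw [← Matrix.mulVec_mulVec, h, ← Matrix.mulVec_mulVec]
  simp [Matrix.mulVec, dotProduct, jac, Finset.sum_apply, mul_comm]

/-- In the product rule, differentiating the loss gradient gives the `ggn` part and differentiating
the model gradient gives the `residual` part. -/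
theorem hasFDerivAt_gradient_objective (hf : ∀ i j, TwiceDifferentiable fun t => f i t j)
    (hℓ : ∀ i, TwiceDifferentiable (ℓ i)) (θ : Vec n) :
    HasFDerivAt (gradient (objective f ℓ)) (Matrix.toEuclideanCLM (𝕜 := ℝ)
      ((N : ℝ)⁻¹ • ∑ i, (ggn f ℓ i θ + residual f ℓ i θ))) θ := by
  have h1 i j := (hasFDerivAt_lossGradient hf hℓ i j θ).smul (hasFDerivAt_gradient (hf i j) θ)
  have h2 := (HasFDerivAt.fun_sum fun i (_ : i ∈ Finset.univ) =>
    HasFDerivAt.fun_sum fun j (_ : j ∈ Finset.univ) => h1 i j).const_smul (N : ℝ)⁻¹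
  rw [funext (gradient_objective hf hℓ)]
  refine h2.congr_fderiv ?_
  ext1 e
  simp only [map_smul, map_sum, map_add, smul_apply,
    sum_apply, add_apply, toEuclideanCLM_residual,
    toEuclideanCLM_ggn hf, Finset.sum_add_distrib, ContinuousLinearMap.smulRight_apply]
  rw [add_comm]
  rfl

/-- Positive definiteness serves only to make the Hessian symmetric, which reconciles the two index
orders. -/
theorem hessian_objective (hf : ∀ i j, TwiceDifferentiable fun t => f i t j)
    (hℓ : ∀ i, TwiceDifferentiable (ℓ i)) (θ : Vec n)
    (hpd : (hessian (objective f ℓ) θ).PosDef) :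
    hessian (objective f ℓ) θ = (N : ℝ)⁻¹ • ∑ i, (ggn f ℓ i θ + residual f ℓ i θ) := by
  have h1 := hasFDerivAt_gradient_objective hf hℓ θ
  set M := (N : ℝ)⁻¹ • ∑ i, (ggn f ℓ i θ + residual f ℓ i θ)
  have h2 : fderiv ℝ (objective f ℓ) = fun t => innerSL ℝ (gradient (objective f ℓ) t) := by
    funext t
    ext e
    simp
  have h3 : HasFDerivAt (fderiv ℝ (objective f ℓ))
      ((innerSL ℝ).comp (Matrix.toEuclideanCLM (𝕜 := ℝ) M)) θ := by
    rw [h2]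
    exact (innerSL ℝ).hasFDerivAt.comp θ h1
  have hsymm : (hessian (objective f ℓ) θ)ᵀ = hessian (objective f ℓ) θ := by
    simpa using hpd.isHermitian.eq
  rw [← hsymm]
  ext a b
  simp [hessian, h3.fderiv, EuclideanSpace.inner_single_right, Matrix.ofLp_toEuclideanCLM]

/-- The increments of the gradient near a point at which the Hessian is Lipschitz. -/
theorem gradient_sub_isBigO {d : ℕ} {g : Vec d → ℝ} (hg : TwiceDifferentiable g) {x : Vec d}
    {L : ℝ} {U : Set (Vec d)} (hU : U ∈ 𝓝 x)
    (hL : ∀ y ∈ U, ‖hessian g y - hessian g x‖ ≤ L * ‖y - x‖) :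
    (fun p : Vec d × Vec d => gradient g p.2 - gradient g p.1 -
      Matrix.toEuclideanCLM (𝕜 := ℝ) (hessian g x) (p.2 - p.1)) =O[𝓝 x ×ˢ 𝓝 x]
      fun p => (‖p.1 - x‖ + ‖p.2 - x‖) * ‖p.2 - p.1‖ := by
  obtain ⟨R, hR, hRU⟩ := Metric.mem_nhds_iff.mp hU
  refine IsBigO.of_bound |L| ?_
  filter_upwards [prod_mem_prod (Metric.ball_mem_nhds x hR) (Metric.ball_mem_nhds x hR)]
    with p hp
  set ρ := ‖p.1 - x‖ + ‖p.2 - x‖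
  have hmem (q : Vec d) (hq : q ∈ Metric.ball x R) (hq' : ‖q - x‖ ≤ ρ) :
      q ∈ Metric.ball x R ∩ Metric.closedBall x ρ := ⟨hq, mem_closedBall_iff_norm.mpr hq'⟩
  -- The mean value inequality on a convex set that contains both points and on which the Hessian
  -- differs from its value at `x` by at most `|L| * ρ`.
  have h := Convex.norm_image_sub_le_of_norm_hasFDerivWithin_le' (𝕜 := ℝ)
    (s := Metric.ball x R ∩ Metric.closedBall x ρ) (C := |L| * ρ)
    (φ := Matrix.toEuclideanCLM (𝕜 := ℝ) (hessian g x))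
    (fun y _ => (hasFDerivAt_gradient hg y).hasFDerivWithinAt) (fun y hy => by
      rw [← map_sub, Matrix.l2_opNorm_toEuclideanCLM]
      refine (hL y (hRU hy.1)).trans ?_
      have h1 : ‖y - x‖ ≤ ρ := mem_closedBall_iff_norm.mp hy.2
      exact mul_le_mul (le_abs_self L) h1 (norm_nonneg _) (abs_nonneg L))
    ((convex_ball x R).inter (convex_closedBall x ρ))
    (hmem p.1 hp.1 (le_add_of_nonneg_right (norm_nonneg _)))
    (hmem p.2 hp.2 (le_add_of_nonneg_left (norm_nonneg _)))
  rw [Real.norm_of_nonneg (by positivity), ← mul_assoc]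
  exact h

/-- Two errors are separated: linearizing the model gradients with the Hessians at `θs`, and
freezing the weights `∂_j ℓ_i` at `θs`. -/
theorem secant_term_isBigO (hf : ∀ i j, TwiceDifferentiable fun t => f i t j)
    (hℓ : ∀ i, TwiceDifferentiable (ℓ i)) {θs : Vec n} (hreg : RegularNear f ℓ θs) (i : Fin N) :
    (fun p : Vec n × Vec n => WithLp.toLp 2
        ((jac (f i) p.2 - jac (f i) p.1) *ᵥ fun j => gradient (ℓ i) (f i p.2) j)
      - Matrix.toEuclideanCLM (𝕜 := ℝ) (residual f ℓ i θs) (p.2 - p.1)) =O[𝓝 θs ×ˢ 𝓝 θs]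
      fun p => (‖p.1 - θs‖ + ‖p.2 - θs‖) * ‖p.2 - p.1‖ := by
  obtain ⟨κl, κl', Ll, κf, κf', Lf, U, hU, -, -, -, hL⟩ := hreg
  have hsplit : (fun p : Vec n × Vec n => WithLp.toLp 2
        ((jac (f i) p.2 - jac (f i) p.1) *ᵥ fun j => gradient (ℓ i) (f i p.2) j)
      - Matrix.toEuclideanCLM (𝕜 := ℝ) (residual f ℓ i θs) (p.2 - p.1)) = fun p => ∑ j,
      (gradient (ℓ i) (f i p.2) j • (gradient (fun t => f i t j) p.2
          - gradient (fun t => f i t j) p.1 - Matrix.toEuclideanCLM (𝕜 := ℝ)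
            (hessian (fun t => f i t j) θs) (p.2 - p.1))
        + (gradient (ℓ i) (f i p.2) j - gradient (ℓ i) (f i θs) j) •
          Matrix.toEuclideanCLM (𝕜 := ℝ) (hessian (fun t => f i t j) θs) (p.2 - p.1)) := by
    funext p
    rw [toEuclideanCLM_residual]
    have : WithLp.toLp 2
        ((jac (f i) p.2 - jac (f i) p.1) *ᵥ fun j => gradient (ℓ i) (f i p.2) j)
        = ∑ j, gradient (ℓ i) (f i p.2) j • (gradient (fun t => f i t j) p.2
          - gradient (fun t => f i t j) p.1) := by
      ext a
      simp [Matrix.mulVec, dotProduct, jac, Finset.sum_apply, mul_comm]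
    rw [this, ← Finset.sum_sub_distrib]
    refine Finset.sum_congr rfl fun j _ => ?_
    module
  rw [hsplit]
  refine IsBigO.fun_sum fun j _ => ?_
  refine IsBigO.add ?_ ?_
  · have h1 : (fun p : Vec n × Vec n => gradient (ℓ i) (f i p.2) j) =O[𝓝 θs ×ˢ 𝓝 θs]
        fun _ => (1 : ℝ) :=
      ((hasFDerivAt_lossGradient hf hℓ i j θs).continuousAt.tendsto.comp tendsto_snd).isBigO_one ℝ
    have h2 := gradient_sub_isBigO (hf i j) hU fun y hy => hL i j y hy θs (mem_of_mem_nhds hU)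
    simpa using h1.smul h2
  · have h1 : (fun p : Vec n × Vec n => gradient (ℓ i) (f i p.2) j - gradient (ℓ i) (f i θs) j)
        =O[𝓝 θs ×ˢ 𝓝 θs] fun p => ‖p.1 - θs‖ + ‖p.2 - θs‖ := by
      have h := (hasFDerivAt_lossGradient hf hℓ i j θs).isBigO_sub.comp_tendsto
        (tendsto_snd (f := 𝓝 θs))
      refine h.trans (IsBigO.of_bound 1 (.of_forall fun p => ?_))
      rw [one_mul, Real.norm_of_nonneg (by positivity)]
      exact le_add_of_nonneg_left (norm_nonneg _)
    have h2 : (fun p : Vec n × Vec n =>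
        Matrix.toEuclideanCLM (𝕜 := ℝ) (hessian (fun t => f i t j) θs) (p.2 - p.1))
        =O[𝓝 θs ×ˢ 𝓝 θs] fun p => ‖p.2 - p.1‖ :=
      ((Matrix.toEuclideanCLM (𝕜 := ℝ) (hessian (fun t => f i t j) θs)).isBigO_comp _ _).norm_right
    simpa using h1.smul h2

theorem tendsto_ggn (hf : ∀ i j, TwiceDifferentiable fun t => f i t j)
    {θs : Vec n} (hreg : RegularNear f ℓ θs) (i : Fin N) :
    Tendsto (ggn f ℓ i) (𝓝 θs) (𝓝 (ggn f ℓ i θs)) := by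
  obtain ⟨κl, κl', Ll, κf, κf', Lf, U, hU, -, hL, -, -⟩ := hreg
  have h1 : Tendsto (fun t => jac (f i) t) (𝓝 θs) (𝓝 (jac (f i) θs)) := by
    refine tendsto_pi_nhds.mpr fun a => tendsto_pi_nhds.mpr fun j => ?_
    exact ((EuclideanSpace.proj (𝕜 := ℝ) a).continuous.tendsto _).comp
      (hasFDerivAt_gradient (hf i j) θs).continuousAt.tendsto
  have h2 : Tendsto (fun t => hessian (ℓ i) (f i t)) (𝓝 θs) (𝓝 (hessian (ℓ i) (f i θs))) := by
    rw [tendsto_iff_norm_sub_tendsto_zero]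
    refine squeeze_zero' (g := fun t => Ll * ‖t - θs‖) (.of_forall fun _ => norm_nonneg _)
      (by filter_upwards [hU] with t ht using hL i t ht θs (mem_of_mem_nhds hU)) ?_
    have h : Continuous fun t : Vec n => Ll * ‖t - θs‖ := by fun_prop
    simpa using h.tendsto θs
  have hc : Continuous fun q : Matrix (Fin n) (Fin m) ℝ × Matrix (Fin m) (Fin m) ℝ =>
      q.1 * q.2 * q.1ᵀ :=
    (continuous_fst.matrix_mul continuous_snd).matrix_mul continuous_fst.matrix_transpose
  have h := (hc.tendsto (jac (f i) θs, hessian (ℓ i) (f i θs))).comp (h1.prodMk_nhds h2)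
  simp only [Function.comp_def] at h
  simpa only [funext (fun t => ggn.eq_1 f ℓ i t)] using h

end Calculus

/-! ### Square summable sequences and the Dennis-Moré theorem. -/

theorem summable_sq_add {a b : ℕ → ℝ} (ha : Summable fun k => a k ^ 2)
    (hb : Summable fun k => b k ^ 2) : Summable fun k => (a k + b k) ^ 2 :=
  ((ha.add hb).mul_left 2).of_nonneg_of_le (fun _ => sq_nonneg _) fun _ => add_sq_le

theorem summable_sq_const_mul {a : ℕ → ℝ} (ha : Summable fun k => a k ^ 2) (c : ℝ) :
    Summable fun k => (c * a k) ^ 2 := by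
  simpa only [mul_pow] using ha.mul_left (c ^ 2)

theorem summable_sq_sum {ι : Type*} (t : Finset ι) {a : ι → ℕ → ℝ}
    (ha : ∀ i, Summable fun k => a i k ^ 2) : Summable fun k => (∑ i ∈ t, a i k) ^ 2 := by
  classical
  induction t using Finset.induction_on with
  | empty => simp
  | insert i t hi ih =>
    simp only [Finset.sum_insert hi]
    exact summable_sq_add (ha i) ih

theorem summable_sq_of_nonneg {a : ℕ → ℝ} (ha0 : ∀ k, 0 ≤ a k) (ha : Summable a) :
    Summable fun k => a k ^ 2 := by
  refine ha.of_norm_bounded_eventually_nat ?_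
  filter_upwards [ha.tendsto_atTop_zero.eventually_le_const zero_lt_one] with k hk
  rw [Real.norm_of_nonneg (sq_nonneg _)]
  nlinarith [ha0 k]

/-- The Dennis-Moré theorem. -/
theorem superlinear_of_dennisMore {n : ℕ} {G : Matrix (Fin n) (Fin n) ℝ} (hG : G.PosDef)
    {g : Vec n → Vec n} {θs : Vec n} (hg0 : g θs = 0)
    (hg : HasFDerivAt g (Matrix.toEuclideanCLM (𝕜 := ℝ) G) θs) {θ : ℕ → Vec n}
    (hθ : Tendsto θ atTop (𝓝 θs)) {B : ℕ → Matrix (Fin n) (Fin n) ℝ}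
    (hstep : ∀ k, Matrix.toEuclideanCLM (𝕜 := ℝ) (B k) (θ (k + 1) - θ k) = -g (θ k))
    (hDM : (fun k => Matrix.toEuclideanCLM (𝕜 := ℝ) (B k - G) (θ (k + 1) - θ k))
      =o[atTop] fun k => θ (k + 1) - θ k) :
    (fun k => ‖θ (k + 1) - θs‖) =o[atTop] fun k => ‖θ k - θs‖ := by
  have h1 : (fun k => g (θ k) - Matrix.toEuclideanCLM (𝕜 := ℝ) G (θ k - θs))
      =o[atTop] fun k => θ k - θs := by
    simpa [hg0, Function.comp_def] using hg.isLittleO.comp_tendsto hθ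
  have h2 : ∀ x : Vec n, ‖x‖ ≤ ‖G⁻¹‖ * ‖Matrix.toEuclideanCLM (𝕜 := ℝ) G x‖ := fun x => by
    have h := (Matrix.toEuclideanCLM (𝕜 := ℝ) G⁻¹).le_opNorm (Matrix.toEuclideanCLM (𝕜 := ℝ) G x)
    rwa [← mul_apply_eq_comp, ← map_mul,
      Matrix.nonsing_inv_mul _ hG.det_pos.ne'.isUnit, map_one, one_apply_eq_self]
      at h
  have h3 : (fun k => θ (k + 1) - θs) =o[atTop] fun k => ‖θ k - θs‖ + ‖θ (k + 1) - θs‖ := by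
    have h4 : (fun k => Matrix.toEuclideanCLM (𝕜 := ℝ) G (θ (k + 1) - θs))
        =o[atTop] fun k => ‖θ k - θs‖ + ‖θ (k + 1) - θs‖ := by
      have h5 : (fun k => θ k - θs) =O[atTop] fun k => ‖θ k - θs‖ + ‖θ (k + 1) - θs‖ :=
        IsBigO.of_bound 1 (.of_forall fun k => by
          rw [one_mul, Real.norm_of_nonneg (by positivity)]
          exact le_add_of_nonneg_right (norm_nonneg _))
      have h6 : (fun k => θ (k + 1) - θ k) =O[atTop] fun k => ‖θ k - θs‖ + ‖θ (k + 1) - θs‖ :=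
        IsBigO.of_bound 1 (.of_forall fun k => by
          rw [one_mul, Real.norm_of_nonneg (by positivity), add_comm ‖θ k - θs‖]
          simpa using norm_sub_le (θ (k + 1) - θs) (θ k - θs))
      -- With `e_k = θ_k - θ*`, one has `-G e_{k+1} = (g(θ_k) - G e_k) + (B_k - G) u_k`.
      refine ((h1.trans_isBigO h5).add (hDM.trans_isBigO h6)).neg_left.congr_left fun k => ?_
      have h7 : θ (k + 1) - θs = (θ (k + 1) - θ k) + (θ k - θs) := by abel
      rw [h7, map_add, map_sub (Matrix.toEuclideanCLM (𝕜 := ℝ)), sub_apply,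
        hstep]
      abel
    exact (IsBigO.of_bound ‖G⁻¹‖ (.of_forall fun k => h2 _)).trans_isLittleO h4
  rw [isLittleO_iff] at h3 ⊢
  intro c hc
  -- The bound `1/2` absorbs the new error into the left side, and `c/2` leaves the constant `c`
  -- after doubling.
  filter_upwards [h3 (show 0 < min (1 / 2) (c / 2) by positivity)] with k hk
  rw [Real.norm_of_nonneg (by positivity)] at hk
  rw [norm_norm, norm_norm]
  have ha := mul_le_mul_of_nonneg_right (min_le_left (1 / 2) (c / 2))
    (norm_nonneg (θ (k + 1) - θs))
  have hb := mul_le_mul_of_nonneg_right (min_le_right (1 / 2) (c / 2)) (norm_nonneg (θ k - θs))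
  rw [mul_add] at hk
  linarith

/-! ### Convergence along one trajectory. -/

section Path

variable {N n m : ℕ} {f : Fin N → Vec n → Vec m} {ℓ : Fin N → Vec m → ℝ}

theorem freq_le_one {s : ℕ} (S : Fin s → Fin N) (i : Fin N) : freq S i ≤ 1 := by
  rcases Nat.eq_zero_or_pos s with rfl | hs
  · simp [freq, sampleMean]
  have hs' : (0 : ℝ) < s := by exact_mod_cast hs
  rw [freq, sampleMean, smul_eq_mul, inv_mul_le_iff₀ hs', mul_one]
  calc _ ≤ ∑ _a : Fin s, (1 : ℝ) := Finset.sum_le_sum fun a _ => by split_ifs <;> norm_num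
    _ = s := by simp

theorem freq_nonneg {s : ℕ} (S : Fin s → Fin N) (i : Fin N) : 0 ≤ freq S i := by
  rw [freq, sampleMean, smul_eq_mul]
  exact mul_nonneg (by positivity) (Finset.sum_nonneg fun a _ => by split_ifs <;> norm_num)

/-- The structured secant vectors are square summable relative perturbations of
`(1/N) ∑ i, Π_i(θ*)` applied to the steps. -/
theorem exists_secantVec_error (hf : ∀ i j, TwiceDifferentiable fun t => f i t j)
    (hℓ : ∀ i, TwiceDifferentiable (ℓ i)) {θs : Vec n} (hreg : RegularNear f ℓ θs)
    {r : ℕ → ℕ} {S : ∀ k, Fin (r k) → Fin N} {θ : ℕ → Vec n}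
    (hfreq : ∀ i, Summable fun k => (freq (S k) i - (N : ℝ)⁻¹) ^ 2)
    (hsum : Summable fun k => ‖θ k - θs‖) (hθ : Tendsto θ atTop (𝓝 θs)) :
    ∃ ε : ℕ → ℝ, (Summable fun k => ε k ^ 2) ∧ ∀ᶠ k in atTop,
      ‖WithLp.toLp 2 (secantVec f ℓ (S k) (θ k) (θ (k + 1)))
        - Matrix.toEuclideanCLM (𝕜 := ℝ) ((N : ℝ)⁻¹ • ∑ i, residual f ℓ i θs)
          (θ (k + 1) - θ k)‖ ≤ ε k * ‖θ (k + 1) - θ k‖ := by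
  choose C hC0 hC using fun i => (secant_term_isBigO hf hℓ hreg i).exists_pos
  have hθ2 : Tendsto (fun k => (θ k, θ (k + 1))) atTop (𝓝 θs ×ˢ 𝓝 θs) :=
    hθ.prodMk (hθ.comp (tendsto_add_atTop_nat 1))
  -- The first part is the linearization error, summable by assumption on the distances; the second
  -- is the sampling error, only square summable.
  refine ⟨fun k => ∑ i, (C i * (‖θ k - θs‖ + ‖θ (k + 1) - θs‖)
    + ‖residual f ℓ i θs‖ * |freq (S k) i - (N : ℝ)⁻¹|), ?_, ?_⟩
  · refine summable_sq_sum _ fun i => summable_sq_add (summable_sq_const_mul ?_ _)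
      (summable_sq_const_mul ?_ _)
    · exact summable_sq_of_nonneg (fun k => by positivity)
        (hsum.add ((summable_nat_add_iff 1).mpr hsum))
    · simpa only [sq_abs] using hfreq i
  · filter_upwards [eventually_all.mpr fun i => hθ2.eventually (hC i).bound] with k hk
    set u := θ (k + 1) - θ k
    have hsplit : WithLp.toLp 2 (secantVec f ℓ (S k) (θ k) (θ (k + 1)))
        - Matrix.toEuclideanCLM (𝕜 := ℝ) ((N : ℝ)⁻¹ • ∑ i, residual f ℓ i θs) u
        = ∑ i, (freq (S k) i • (WithLp.toLp 2
          ((jac (f i) (θ (k + 1)) - jac (f i) (θ k)) *ᵥ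
            fun j => gradient (ℓ i) (f i (θ (k + 1))) j)
          - Matrix.toEuclideanCLM (𝕜 := ℝ) (residual f ℓ i θs) u)
          + (freq (S k) i - (N : ℝ)⁻¹) •
            Matrix.toEuclideanCLM (𝕜 := ℝ) (residual f ℓ i θs) u) := by
      rw [secantVec, sampleMean_eq_sum_freq, WithLp.toLp_sum, map_smul, map_sum, smul_apply,
        sum_apply, Finset.smul_sum, ← Finset.sum_sub_distrib]
      refine Finset.sum_congr rfl fun i _ => ?_
      rw [WithLp.toLp_smul]
      module
    rw [hsplit, Finset.sum_mul]
    refine norm_sum_le_of_le _ fun i _ => ?_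
    have h1 := hk i
    rw [Real.norm_of_nonneg (by positivity)] at h1
    have h2 := (Matrix.toEuclideanCLM (𝕜 := ℝ) (residual f ℓ i θs)).le_opNorm u
    rw [Matrix.l2_opNorm_toEuclideanCLM] at h2
    rw [add_mul]
    refine norm_add_le_of_le ?_ ?_
    · rw [norm_smul, Real.norm_of_nonneg (freq_nonneg _ _), mul_assoc]
      exact (mul_le_of_le_one_left (norm_nonneg _) (freq_le_one _ _)).trans h1
    · rw [norm_smul, Real.norm_eq_abs]
      calc _ ≤ |freq (S k) i - (N : ℝ)⁻¹| * (‖residual f ℓ i θs‖ * ‖u‖) := by gcongr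
        _ = _ := by ring

theorem tendsto_subsampledGGN (hf : ∀ i j, TwiceDifferentiable fun t => f i t j)
    {θs : Vec n} (hreg : RegularNear f ℓ θs)
    {r : ℕ → ℕ} {S : ∀ k, Fin (r k) → Fin N} {θ : ℕ → Vec n}
    (hfreq : ∀ i, Summable fun k => (freq (S k) i - (N : ℝ)⁻¹) ^ 2)
    (hθ : Tendsto θ atTop (𝓝 θs)) :
    Tendsto (fun k => subsampledGGN f ℓ (S k) (θ k)) atTop
      (𝓝 ((N : ℝ)⁻¹ • ∑ i, ggn f ℓ i θs)) := by
  simp only [subsampledGGN, sampleMean_eq_sum_freq, Finset.smul_sum]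
  refine tendsto_finsetSum _ fun i _ => ?_
  have h1 : Tendsto (fun k => freq (S k) i - (N : ℝ)⁻¹) atTop (𝓝 0) := by
    rw [tendsto_zero_iff_abs_tendsto_zero]
    simpa [Function.comp_def, Real.sqrt_sq_eq_abs] using (hfreq i).tendsto_atTop_zero.sqrt
  have h2 : Tendsto (fun k => freq (S k) i) atTop (𝓝 (N : ℝ)⁻¹) := by
    simpa using h1.add_const (N : ℝ)⁻¹
  exact h2.smul ((tendsto_ggn hf hreg i).comp hθ)

/-- Superlinear convergence along one trajectory. -/
theorem superlinear_of_path (hf : ∀ i j, TwiceDifferentiable fun t => f i t j)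
    (hℓ : ∀ i, TwiceDifferentiable (ℓ i)) {θs : Vec n}
    (hopt : IsLocalMin (objective f ℓ) θs) (hpd : (hessian (objective f ℓ) θs).PosDef)
    (hres : ((N : ℝ)⁻¹ • ∑ i, residual f ℓ i θs).PosDef) (hreg : RegularNear f ℓ θs)
    {r : ℕ → ℕ} {S : ∀ k, Fin (r k) → Fin N} {θ : ℕ → Vec n}
    {Λ B : ℕ → Matrix (Fin n) (Fin n) ℝ}
    (hfreq : ∀ i, Summable fun k => (freq (S k) i - (N : ℝ)⁻¹) ^ 2)
    (hB : ∀ k, B k = subsampledGGN f ℓ (S k) (θ k) + Λ k) (hBinv : ∀ k, IsUnit (B k))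
    (hθ : ∀ k, θ (k + 1) =
      θ k - Matrix.toEuclideanCLM (𝕜 := ℝ) (B k)⁻¹ (gradient (objective f ℓ) (θ k)))
    (hΛ : GeneratedByBFGS Λ (fun k => (θ (k + 1) - θ k).ofLp)
      (fun k => secantVec f ℓ (S k) (θ k) (θ (k + 1))))
    (hsum : Summable fun k => ‖θ k - θs‖) :
    Tendsto θ atTop (𝓝 θs) ∧
      (fun k => ‖θ (k + 1) - θs‖) =o[atTop] fun k => ‖θ k - θs‖ := by
  have hlim : Tendsto θ atTop (𝓝 θs) :=
    tendsto_iff_norm_sub_tendsto_zero.mpr hsum.tendsto_atTop_zero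
  refine ⟨hlim, ?_⟩
  have hBu k : Matrix.toEuclideanCLM (𝕜 := ℝ) (B k) (θ (k + 1) - θ k)
      = -gradient (objective f ℓ) (θ k) := by
    rw [hθ k, sub_sub_cancel_left, map_neg, ← mul_apply_eq_comp, ← map_mul,
      Matrix.mul_nonsing_inv _ ((Matrix.isUnit_iff_isUnit_det _).mp (hBinv k)), map_one,
      one_apply_eq_self]
  by_cases hu : ∀ᶠ k in atTop, θ (k + 1) - θ k ≠ 0
  · have hg0 : gradient (objective f ℓ) θs = 0 := by
      rw [gradient, hopt.fderiv_eq_zero, map_zero]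
    obtain ⟨ε, hε, hv⟩ := exists_secantVec_error hf hℓ hreg hfreq hsum hlim
    have hDM1 := bfgs_isLittleO hres hΛ hu hε hv
    have hH := tendsto_subsampledGGN hf hreg hfreq hlim
    have hG := hessian_objective hf hℓ θs hpd
    have hDM2 : (fun k => Matrix.toEuclideanCLM (𝕜 := ℝ) (subsampledGGN f ℓ (S k) (θ k)
        - (N : ℝ)⁻¹ • ∑ i, ggn f ℓ i θs) (θ (k + 1) - θ k)) =o[atTop]
        fun k => θ (k + 1) - θ k := by
      rw [isLittleO_iff]
      intro c hc
      filter_upwards [(tendsto_iff_norm_sub_tendsto_zero.mp hH).eventually_le_const hc] with k hk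
      exact ContinuousLinearMap.le_of_opNorm_le _ hk _
    refine superlinear_of_dennisMore hpd hg0 (hG ▸ hasFDerivAt_gradient_objective hf hℓ θs) hlim
      hBu ((hDM2.add hDM1).congr_left fun k => ?_)
    rw [hG, hB k, ← add_apply, ← map_add, Finset.sum_add_distrib, smul_add]
    congr 2
    abel
  -- A single zero step means a zero gradient, so the iterates stay put from there on; the constant
  -- value must be the limit `θs`.
  · obtain ⟨K, hK⟩ := (Filter.not_eventually.mp hu).exists
    rw [not_not] at hK
    have hgK : gradient (objective f ℓ) (θ K) = 0 := by
      have := hBu K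
      rw [hK, map_zero] at this
      exact neg_eq_zero.mp this.symm
    have hconst k : θ (K + k) = θ K := by
      induction k with
      | zero => rfl
      | succ k ih => rw [← add_assoc, hθ (K + k), ih, hgK, map_zero, sub_zero]
    have hKs : θ K = θs := by
      refine tendsto_nhds_unique (tendsto_const_nhds.congr' ?_) hlim
      filter_upwards [eventually_ge_atTop K] with k hk
      rw [← hconst (k - K), Nat.add_sub_cancel' hk]
    refine (isLittleO_zero (E' := ℝ) _ _).congr' ?_ EventuallyEq.rfl
    filter_upwards [eventually_ge_atTop K] with k hk
    have := hconst (k + 1 - K)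
    rw [Nat.add_sub_cancel' (by omega), hKs] at this
    simp [this]

theorem mean_residual_posDef {θs : Vec n} (hN : 0 < N) {lam : ℝ} (hlam : 0 < lam)
    (hres : ∀ i, (residual f ℓ i θs - lam • (1 : Matrix (Fin n) (Fin n) ℝ)).PosSemidef) :
    ((N : ℝ)⁻¹ • ∑ i, residual f ℓ i θs).PosDef := by
  have h i : (residual f ℓ i θs).PosDef := by
    simpa using Matrix.PosDef.add_posSemidef (Matrix.PosDef.one.smul hlam) (hres i)
  have : Nonempty (Fin N) := ⟨⟨0, hN⟩⟩
  exact (Matrix.posDef_sum Finset.univ_nonempty fun i _ => h i).smul (by positivity)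

end Path

end S2QN

theorem mainTheorem3 {N n m : ℕ}
    (f : Fin N → S2QN.Vec n → S2QN.Vec m) (ℓ : Fin N → S2QN.Vec m → ℝ)
    (hf : ∀ i j, S2QN.TwiceDifferentiable fun t => f i t j)
    (hℓ : ∀ i, S2QN.TwiceDifferentiable (ℓ i))
    -- the optimal point and the local assumptions on the problem
    (θs : S2QN.Vec n)
    (hopt : IsLocalMin (S2QN.objective f ℓ) θs)
    (hpd : (S2QN.hessian (S2QN.objective f ℓ) θs).PosDef)
    (lam : ℝ) (hlam : 0 < lam)
    (hres : ∀ i, (S2QN.residual f ℓ i θs - lam • (1 : Matrix (Fin n) (Fin n) ℝ)).PosSemidef)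
    (hreg : S2QN.RegularNear f ℓ θs)
    -- the samples
    {Ω : Type*} [MeasurableSpace Ω] (μ : Measure Ω) [IsProbabilityMeasure μ]
    (s : ℕ → ℕ) (hs : S2QN.SuperlinearGrowth s)
    {r : ℕ → ℕ} (S : ∀ k, Ω → Fin (r k) → Fin N)
    (hS : S2QN.UniformSampling μ s S)
    -- the iteration
    (θ : ℕ → Ω → S2QN.Vec n) (Λ B : ℕ → Ω → Matrix (Fin n) (Fin n) ℝ)
    (hB : ∀ᵐ ω ∂μ, ∀ k, B k ω = S2QN.subsampledGGN f ℓ (S k ω) (θ k ω) + Λ k ω)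
    (hBinv : ∀ᵐ ω ∂μ, ∀ k, IsUnit (B k ω))
    (hθ : ∀ᵐ ω ∂μ, ∀ k, θ (k + 1) ω =
      θ k ω - Matrix.toEuclideanCLM (𝕜 := ℝ) (B k ω)⁻¹ (gradient (S2QN.objective f ℓ) (θ k ω)))
    (hΛ : ∀ᵐ ω ∂μ, S2QN.GeneratedByBFGS (fun k => Λ k ω)
      (fun k => (θ (k + 1) ω - θ k ω).ofLp)
      (fun k => S2QN.secantVec f ℓ (S k ω) (θ k ω) (θ (k + 1) ω)))
    -- summable distances
    (hsum : ∀ᵐ ω ∂μ, Summable fun k => ‖θ k ω - θs‖) :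
    ∀ᵐ ω ∂μ, Tendsto (fun k => θ k ω) atTop (𝓝 θs) ∧
      (fun k => ‖θ (k + 1) ω - θs‖) =o[atTop] (fun k => ‖θ k ω - θs‖) := by
  have hmean : ((N : ℝ)⁻¹ • ∑ i, S2QN.residual f ℓ i θs).PosDef := by
    rcases Nat.eq_zero_or_pos N with rfl | hN
    -- For `N = 0` both means are empty sums, so the mean residual equals the Hessian and inherits
    -- its positive definiteness.
    · have h := S2QN.hessian_objective hf hℓ θs hpd
      simp only [Finset.univ_eq_empty, Finset.sum_empty, smul_zero] at h ⊢
      rwa [h] at hpd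
    · exact S2QN.mean_residual_posDef hN hlam hres
  filter_upwards [hB, hBinv, hθ, hΛ, hsum, S2QN.summable_sq_freq_sub hs hS]
    with ω hB hBinv hθ hΛ hsum hfreq
  exact S2QN.superlinear_of_path hf hℓ hopt hpd hmean hreg hfreq hB hBinv hθ hΛ hsum
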